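/- **Theorem (Irreducibility of $W(\lambda)$).** Let $\mathbb T$ be the set of isomorphism classes of nonempty finite rooted trees, $|t|$ the number of vertices of $t$, and $\mathbb C\mathbb T$ the complex vector space with basis $\mathbb T$. For $t\in\mathbb T$ define linear operators on $\mathbb C\mathbb T$ by $$D^+_t(s)=\sum_{v\in V(s)} s\cup_v t,\qquad D^-_t(s)=\sum_{e\in E(s),\ P_e(s)=t} R_e(s),\qquad d(s)=|s|\,s\qquad(s\in\mathbb T),$$ where $s\cup_v t$ is obtained by joining the root of $t$ to the vertex $v$ of $s$ by an edge (keeping the root of $s$), and cutting $s$ along an edge $e$ leaves the component $R_e(s)$ containing the root and the other component $P_e(s)$, rooted at the endpoint of $e$. Let $\mathfrak g$ (the insertion-elimination Lie algebra) be the Lie algebra of operators on $\mathbb C\mathbb T$ generated by all $D^+_t$, all $D^-_t$ and $d$, and let $\mathfrak n_-$ be the Lie subalgebra generated by all $D^-_t$. For $\lambda\in\mathbb C$ let $\mathbb C_\lambda$ be the one-dimensional representation of $\mathbb C d\oplus\mathfrak n_-$ on which $\mathfrak n_-$ acts by $0$ and $d$ by $\lambda$, and let $$W(\lambda)=U(\mathfrak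 g)\otimes_{\mathbb C[d]\otimes U(\mathfrak n_-)}\mathbb C_\lambda ,$$ that is, the quotient of the left $U(\mathfrak g)$-module $U(\mathfrak g)\otimes_{\mathbb C}\mathbb C_\lambda$ by the relations $u\,p(d)\,y\otimes z=u\otimes p(d)\,y\,z$ for $u\in U(\mathfrak g)$, $p\in\mathbb C[X]$, $y\in U(\mathfrak n_-)$, $z\in\mathbb C_\lambda$. Then there is a countable set $S\subset\mathbb C$ with $0\in S$ such that the $\mathfrak g$-module $W(\lambda)$ is irreducible for every $\lambda\in\mathbb C\setminus S$; moreover $W(0)$ is not irreducible. -/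

import Mathlib

open scoped TensorProduct

attribute [local instance 100] LieRing.ofAssociativeRing

noncomputable section

namespace InsElim

/-- Rooted trees in which the children of every vertex carry a linear order. `dot` is the tree with
one vertex. `join c s` is obtained from the disjoint union of `c` and `s` by adding an edge between
the two roots; its root is the root of `s`, and `c` becomes the first branch at the root. -/
inductive PlaneTree : Type
  | dot : PlaneTree
  | join : PlaneTree → PlaneTree → PlaneTree

namespace PlaneTree

/-- Exchanging two neighbouring branches at some vertex. -/
inductive Swap : PlaneTree → PlaneTree → Prop
  | swap (a b s : PlaneTree) : Swap (join a (join b s)) (join b (join a s))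
  | inBranch {c c' : PlaneTree} (s : PlaneTree) : Swap c c' → Swap (join c s) (join c' s)
  | inRest (c : PlaneTree) {s s' : PlaneTree} : Swap s s' → Swap (join c s) (join c s')

/-- The number of vertices. -/
def size : PlaneTree → ℕ
  | dot => 1
  | join c s => size c + size s

end PlaneTree

/-- The set `𝕋` of (nonempty, finite) rooted trees up to isomorphism: plane rooted trees modulo
reordering the branches at the vertices. -/
def RTree : Type := Quot PlaneTree.Swap

namespace RTree

/-- The isomorphism class of a plane tree. -/
def mk (a : PlaneTree) : RTree := Quot.mk _ a

theorem mk_eq_of_swap {a b : PlaneTree} (h : PlaneTree.Swap a b) : mk a = mk b := Quot.sound h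

/-- The rooted tree with one vertex. -/
def dot : RTree := mk PlaneTree.dot

/-- `join c s` is `s` with `c` joined by an edge to the root of `s`. -/
def join : RTree → RTree → RTree :=
  Quot.map₂ PlaneTree.join (fun c _ _ h => PlaneTree.Swap.inRest c h)
    (fun _ _ s h => PlaneTree.Swap.inBranch s h)

theorem mk_join (c s : PlaneTree) : mk (c.join s) = join (mk c) (mk s) := rfl

theorem join_left_comm (a b s : RTree) : join a (join b s) = join b (join a s) := by
  induction a using Quot.ind
  induction b using Quot.ind
  induction s using Quot.ind
  exact Quot.sound (PlaneTree.Swap.swap _ _ _)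

/-- `|t|`, the number of vertices. -/
def size : RTree → ℕ :=
  Quot.lift PlaneTree.size (by
    intro a b h
    induction h with
    | swap a b s => simp only [PlaneTree.size]; omega
    | inBranch s _ ih => simp only [PlaneTree.size, ih]
    | inRest c _ ih => simp only [PlaneTree.size, ih])

/-- The vertices of `join c s` are those of `c` and those of `s`. -/
def graftPlane (t : RTree) : PlaneTree → Multiset RTree
  | .dot => {join t dot}
  | .join c s =>
      (graftPlane t c).map (fun u => join u (mk s)) +
      (graftPlane t s).map (fun u => join (mk c) u)

theorem graftPlane_swap (t : RTree) {a b : PlaneTree} (h : PlaneTree.Swap a b) :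
    graftPlane t a = graftPlane t b := by
  induction h with
  | swap a b s =>
    simp only [graftPlane, Multiset.map_add, Multiset.map_map, Function.comp_def, mk_join]
    have h1 (u : RTree) : join u (join (mk b) (mk s)) = join (mk b) (join u (mk s)) :=
      join_left_comm _ _ _
    have h2 (u : RTree) : join u (join (mk a) (mk s)) = join (mk a) (join u (mk s)) :=
      join_left_comm _ _ _
    have h3 (u : RTree) : join (mk b) (join (mk a) u) = join (mk a) (join (mk b) u) :=
      join_left_comm _ _ _
    simp_rw [h1]
    simp_rw [h2]
    simp_rw [h3]
    abel
  | inBranch s h ih => simp only [graftPlane, ih, mk_eq_of_swap h]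
  | inRest c h ih => simp only [graftPlane, ih, mk_eq_of_swap h]

/-- The family of trees `s ∪_v t`, one for each vertex `v` of `s`, where `s ∪_v t` is obtained by
joining the root of `t` to `v` by an edge (the root is that of `s`). -/
def graft (t s : RTree) : Multiset RTree :=
  Quot.lift (graftPlane t) (fun _ _ h => graftPlane_swap t h) s

/-- The edges of `join c s` are the new one and those of `c` and of `s`. -/
def cutsPlane : PlaneTree → Multiset (RTree × RTree)
  | .dot => 0
  | .join c s =>
      {(mk c, mk s)} +
      ((cutsPlane c).map (fun e => (e.1, join e.2 (mk s))) +
       (cutsPlane s).map (fun e => (e.1, join (mk c) e.2)))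

theorem cutsPlane_swap {a b : PlaneTree} (h : PlaneTree.Swap a b) :
    cutsPlane a = cutsPlane b := by
  induction h with
  | swap a b s =>
    simp only [cutsPlane, Multiset.map_add, Multiset.map_map, Multiset.map_singleton,
      Function.comp_def, mk_join]
    have h1 (u : RTree) : join u (join (mk b) (mk s)) = join (mk b) (join u (mk s)) :=
      join_left_comm _ _ _
    have h2 (u : RTree) : join u (join (mk a) (mk s)) = join (mk a) (join u (mk s)) :=
      join_left_comm _ _ _
    have h3 (u : RTree) : join (mk b) (join (mk a) u) = join (mk a) (join (mk b) u) :=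
      join_left_comm _ _ _
    simp_rw [h1]
    simp_rw [h2]
    simp_rw [h3]
    abel
  | inBranch s h ih => simp only [cutsPlane, ih, mk_eq_of_swap h]
  | inRest c h ih => simp only [cutsPlane, ih, mk_eq_of_swap h]

/-- The family of pairs `(P_e(s), R_e(s))`, one for each edge `e` of `s`: cutting `s` along `e`
leaves the component `R_e(s)` that contains the root and the other component `P_e(s)`, rooted at
the endpoint of `e`. -/
def cuts (s : RTree) : Multiset (RTree × RTree) :=
  Quot.lift cutsPlane (fun _ _ h => cutsPlane_swap h) s

end RTree

/-- The complex vector space with basis the rooted trees. -/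
abbrev TreeSpace : Type := RTree →₀ ℂ

/-- `D⁺_t s = ∑_{v ∈ V(s)} s ∪_v t`. -/
def Dplus (t : RTree) : Module.End ℂ TreeSpace :=
  Finsupp.linearCombination ℂ
    (fun s => ((RTree.graft t s).map (fun u => Finsupp.single u (1 : ℂ))).sum)

open Classical in
/-- `D⁻_t s = ∑_{e ∈ E(s), P_e(s) = t} R_e(s)`. -/
def Dminus (t : RTree) : Module.End ℂ TreeSpace :=
  Finsupp.linearCombination ℂ
    (fun s => (((RTree.cuts s).filter (fun e => e.1 = t)).map
      (fun e => Finsupp.single e.2 (1 : ℂ))).sum)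

/-- `d s = |s| s`. -/
def degOp : Module.End ℂ TreeSpace :=
  Finsupp.linearCombination ℂ (fun s => Finsupp.single s (RTree.size s : ℂ))

/-- The insertion-elimination Lie algebra: the Lie algebra of operators on the space of rooted trees
generated by all `D⁺_t`, all `D⁻_t` and `d`. -/
def insElim : LieSubalgebra ℂ (Module.End ℂ TreeSpace) :=
  LieSubalgebra.lieSpan ℂ (Module.End ℂ TreeSpace)
    (Set.range Dplus ∪ Set.range Dminus ∪ {degOp})

/-- `d` as an element of the Lie algebra. -/
def dElt : insElim :=
  ⟨degOp, LieSubalgebra.subset_lieSpan (Or.inr rfl)⟩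

/-- `D⁻_t` as an element of the Lie algebra. -/
def DminusElt (t : RTree) : insElim :=
  ⟨Dminus t, LieSubalgebra.subset_lieSpan (Or.inl (Or.inr ⟨t, rfl⟩))⟩

/-- `𝔫₋`, the Lie subalgebra generated by the `D⁻_t`. -/
def nMinus : LieSubalgebra ℂ insElim :=
  LieSubalgebra.lieSpan ℂ insElim (Set.range DminusElt)

/-- The universal enveloping algebra `U(𝔤)`. -/
abbrev Ug : Type := UniversalEnvelopingAlgebra ℂ insElim

/-- The universal enveloping algebra `U(𝔫₋)`. -/
abbrev Un : Type := UniversalEnvelopingAlgebra ℂ nMinus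

/-- The map `U(𝔫₋) → U(𝔤)` induced by the inclusion. -/
def unIncl : Un →ₐ[ℂ] Ug :=
  UniversalEnvelopingAlgebra.lift ℂ ((UniversalEnvelopingAlgebra.ι ℂ).comp nMinus.incl)

/-- The map `ℂ[d] ⊗ U(𝔫₋) → U(𝔤)`, on the pure tensor `p ⊗ y`. -/
def lowerIncl (p : Polynomial ℂ) (y : Un) : Ug :=
  Polynomial.aeval (UniversalEnvelopingAlgebra.ι ℂ dElt : Ug) p * unIncl y

/-- The scalar by which the pure tensor `p ⊗ y` of `ℂ[d] ⊗ U(𝔫₋)` acts on `ℂ_λ`: `d` acts by `λ`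
and `𝔫₋` acts trivially. -/
def lowerScalar (lam : ℂ) (p : Polynomial ℂ) (y : Un) : ℂ :=
  p.eval lam * UniversalEnvelopingAlgebra.lift ℂ (0 : nMinus →ₗ⁅ℂ⁆ ℂ) y

/-- The relations `u a ⊗ z = u ⊗ a z` for `a ∈ ℂ[d] ⊗ U(𝔫₋)`. -/
def balanceRel (lam : ℂ) : Submodule Ug (Ug ⊗[ℂ] ℂ) :=
  Submodule.span Ug
    {x | ∃ (u : Ug) (p : Polynomial ℂ) (y : Un) (z : ℂ),
      x = (u * lowerIncl p y) ⊗ₜ[ℂ] z - u ⊗ₜ[ℂ] (lowerScalar lam p y * z)}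

/-- The Verma module `W(λ) = U(𝔤) ⊗_{ℂ[d] ⊗ U(𝔫₋)} ℂ_λ`, a left `U(𝔤)`-module, that is, a
`𝔤`-module. -/
abbrev Verma (lam : ℂ) : Type := (Ug ⊗[ℂ] ℂ) ⧸ balanceRel lam

end InsElim

end

noncomputable section

namespace InsElim

open Finsupp (single)

/-! ### Rooted trees as multisets of branches -/

namespace RTree

/-! The exceptional set can be taken to be `{0}`. A rooted tree is the multiset of its branches, so
`TreeSpace` is a polynomial algebra whose variables are the trees: the product identifies roots,
`dot` is the unit, and `joinL a` is multiplication by a linear form. Each generator `D` of the Lie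
algebra satisfies `D (joinL a b) = joinL (D a) b + joinL a (D b) + l a • b` for a linear functional
`l`, and is determined by `l` and `D dot`. Hence the Lie algebra is spanned by the `D⁺_t`, the
`D⁻_t` and `d` (`exists_eq_plus_add_minus`).

The same rule says that `D` is a derivation of the polynomial algebra plus multiplication by `D
dot`. Rescaling the multiplication part by `1 + mu` still gives a representation, `fock mu`, in
which `dot` is killed by the `D⁻_t` and has weight `lam = 1 + mu`.

For `lam ≠ 0`, two facts give irreducibility. Commutation relations show that ordered monomials in
the `D⁺_t` applied to the lowest weight vector span `W(lam)` (`exists_monomial_smul_eq`); in `fock`,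
such a monomial sends `dot` to a nonzero power of `lam` times the corresponding tree plus trees with
fewer branches, so nothing is lost in passing to `fock` (`eq_zero_of_fockU_monomial`). And in `fock`
the `D⁻_t` lower any nonzero vector to a multiple of `dot` (`exists_fockU_eq_dot`).

For `lam = 0`, the Lie algebra kills `dot` in `fock (-1)`, so `D⁺_dot` applied to the lowest weight
vector cannot generate that vector. It is nonzero because its image is nonzero in the tensor product
of the `fock` modules of weights `1` and `-1`. -/

@[elab_as_elim]
theorem ind {P : RTree → Prop} (dot : P dot) (join : ∀ c s, P c → P s → P (join c s)) (t : RTree) :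
    P t := by
  induction t using Quot.ind with
  | mk a =>
    induction a with
    | dot => exact dot
    | join c s hc hs => exact join _ _ hc hs

@[simp]
theorem size_dot : size dot = 1 := rfl

@[simp]
theorem size_join (c s : RTree) : size (join c s) = size c + size s := by
  induction c using Quot.ind
  induction s using Quot.ind
  rfl

theorem size_pos (s : RTree) : 0 < size s := by
  induction s using ind with
  | dot => simp
  | join c s hc hs => simp; omega

theorem graft_dot (t : RTree) : graft t dot = {join t dot} := rfl

theorem graft_join (t c s : RTree) :
    graft t (join c s) =
      (graft t c).map (fun u => join u s) + (graft t s).map (fun u => join c u) := by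
  induction c using Quot.ind
  induction s using Quot.ind
  rfl

theorem cuts_dot : cuts dot = 0 := rfl

theorem cuts_join (c s : RTree) :
    cuts (join c s) = {(c, s)} + ((cuts c).map (fun e => (e.1, join e.2 s)) +
      (cuts s).map (fun e => (e.1, join c e.2))) := by
  induction c using Quot.ind
  induction s using Quot.ind
  rfl

/-- The branches at the root of a plane tree. -/
def branchesPlane : PlaneTree → Multiset RTree
  | .dot => 0
  | .join c s => mk c ::ₘ branchesPlane s

theorem branchesPlane_swap {a b : PlaneTree} (h : PlaneTree.Swap a b) :
    branchesPlane a = branchesPlane b := by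
  induction h with
  | swap a b s => exact Multiset.cons_swap _ _ _
  | inBranch s h ih => simp only [branchesPlane, mk_eq_of_swap h]
  | inRest c h ih => simp only [branchesPlane, ih]

/-- The multiset of branches at the root. -/
def branches (s : RTree) : Multiset RTree :=
  Quot.lift branchesPlane (fun _ _ h => branchesPlane_swap h) s

@[simp]
theorem branches_dot : branches dot = 0 := rfl

@[simp]
theorem branches_join (c s : RTree) : branches (join c s) = c ::ₘ branches s := by
  induction c using Quot.ind
  induction s using Quot.ind
  rfl

instance : LeftCommutative join := ⟨join_left_comm⟩

/-- The tree with prescribed branches at the root. -/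
def ofBranches (m : Multiset RTree) : RTree := m.foldr join dot

@[simp]
theorem ofBranches_zero : ofBranches 0 = dot := Multiset.foldr_zero _ _

@[simp]
theorem ofBranches_cons (c : RTree) (m : Multiset RTree) :
    ofBranches (c ::ₘ m) = join c (ofBranches m) := Multiset.foldr_cons _ _ _ _

@[simp]
theorem ofBranches_branches (s : RTree) : ofBranches (branches s) = s := by
  induction s using ind with
  | dot => simp
  | join c s _ hs => simp [hs]

@[simp]
theorem branches_ofBranches (m : Multiset RTree) : branches (ofBranches m) = m := by
  induction m using Multiset.induction with
  | empty => simp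
  | cons c m h => simp [h]

theorem branches_injective : Function.Injective branches :=
  Function.LeftInverse.injective ofBranches_branches

theorem join_dot_injective : Function.Injective (fun t => join t dot) := by
  intro a b h
  simpa using congrArg branches h

theorem join_ne_dot (c s : RTree) : join c s ≠ dot := by
  intro h
  simpa using congrArg branches h

/-- This turns a functional vanishing on large trees into a finitely supported vector, hence into a
finite combination of the `D⁻_t`. -/
theorem finite_size_le (n : ℕ) : {s : RTree | size s ≤ n}.Finite := by
  induction n with
  | zero =>
    convert Set.finite_empty
    ext s
    simpa using (size_pos s).ne'
  | succ n ih =>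
    refine ((Set.finite_singleton dot).union (ih.image2 join ih)).subset ?_
    intro s
    induction s using ind with
    | dot => intro _; exact Or.inl rfl
    | join c s _ _ =>
      intro h
      have h1 : size c + size s ≤ n + 1 := by simpa using h
      have := size_pos c
      have := size_pos s
      exact Or.inr (Set.mem_image2_of_mem (by simp; omega) (by simp; omega))

end RTree

/-! ### Operators with a Leibniz rule -/

open RTree (dot join branches ofBranches size)

/-- The basis vector of `TreeSpace` given by a tree. -/
abbrev vec (s : RTree) : TreeSpace := single s 1

/-- The bilinear extension of `RTree.join`. -/
def joinL : TreeSpace →ₗ[ℂ] TreeSpace →ₗ[ℂ] TreeSpace :=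
  Finsupp.linearCombination ℂ (fun c => Finsupp.lmapDomain ℂ ℂ (join c))

@[simp]
theorem joinL_vec (c s : RTree) : joinL (vec c) (vec s) = vec (join c s) := by
  simp [joinL, Finsupp.mapDomain_single]

theorem vec_induction {P : TreeSpace → Prop} (zero : P 0) (add : ∀ a b, P a → P b → P (a + b))
    (smul : ∀ (z : ℂ) a, P a → P (z • a)) (basis : ∀ s, P (vec s)) (a : TreeSpace) : P a := by
  induction a using Finsupp.induction_linear with
  | zero => exact zero
  | add f g hf hg => exact add _ _ hf hg
  | single s z =>
    have := smul z _ (basis s)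
    rwa [Finsupp.smul_single, smul_eq_mul, mul_one] at this

theorem end_ext_vec {M : Type*} [AddCommGroup M] [Module ℂ M] {f g : TreeSpace →ₗ[ℂ] M}
    (h : ∀ s, f (vec s) = g (vec s)) : f = g :=
  Finsupp.lhom_ext' fun s => LinearMap.ext_ring (h s)

theorem joinL_left_comm (a b s : TreeSpace) : joinL a (joinL b s) = joinL b (joinL a s) := by
  induction a using vec_induction with
  | zero => simp
  | add a a' h h' => simp [h, h']
  | smul z a h => simp [h]
  | basis a =>
  induction b using vec_induction with
  | zero => simp
  | add a a' h h' => simp [h, h']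
  | smul z a h => simp [h]
  | basis b =>
  induction s using vec_induction with
  | zero => simp
  | add a a' h h' => simp [h, h']
  | smul z a h => simp [h]
  | basis s => simp [RTree.join_left_comm a b s]

/-- `D` is a derivation with respect to `joinL`, up to the term in which a branch `c` is replaced by
the scalar `ℓ c`. -/
def IsLeibniz (D : Module.End ℂ TreeSpace) (l : TreeSpace →ₗ[ℂ] ℂ) : Prop :=
  ∀ a b, D (joinL a b) = joinL (D a) b + joinL a (D b) + l a • b

theorem isLeibniz_of_vec {D : Module.End ℂ TreeSpace} {l : TreeSpace →ₗ[ℂ] ℂ}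
    (h : ∀ c s, D (vec (join c s)) =
      joinL (D (vec c)) (vec s) + joinL (vec c) (D (vec s)) + l (vec c) • vec s) :
    IsLeibniz D l := by
  intro a b
  induction a using vec_induction with
  | zero => simp
  | add a a' h h' => simp only [map_add, LinearMap.add_apply, h, h', add_smul]; abel
  | smul z a h => simp only [map_smul, LinearMap.smul_apply, h, smul_add, smul_assoc]
  | basis c =>
  induction b using vec_induction with
  | zero => simp
  | add a a' h h' => simp only [map_add, h, h', smul_add]; abel
  | smul z a h => simp only [map_smul, h, smul_add, smul_comm z]
  | basis s => rw [joinL_vec, h]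

namespace IsLeibniz

variable {D E : Module.End ℂ TreeSpace} {l m : TreeSpace →ₗ[ℂ] ℂ}

theorem zero : IsLeibniz 0 0 := fun a b => by simp

theorem add (hD : IsLeibniz D l) (hE : IsLeibniz E m) : IsLeibniz (D + E) (l + m) := fun a b => by
  simp only [LinearMap.add_apply, hD a b, hE a b, map_add, add_smul]; abel

theorem smul (z : ℂ) (hD : IsLeibniz D l) : IsLeibniz (z • D) (z • l) := fun a b => by
  simp only [LinearMap.smul_apply, hD a b, map_smul, smul_add, smul_assoc]

/-- The mixed terms, and the terms `l a • E b` and `m a • D b`, cancel in the commutator; only the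
values of `l` and `m` on the transformed branch survive. -/
theorem lie (hD : IsLeibniz D l) (hE : IsLeibniz E m) :
    IsLeibniz (D * E - E * D) (l ∘ₗ E - m ∘ₗ D) := fun a b => by
  simp only [LinearMap.sub_apply, Module.End.mul_apply, LinearMap.comp_apply]
  rw [hD a b, hE a b]
  simp only [map_add, map_sub, map_smul, sub_smul, LinearMap.sub_apply]
  rw [hD (E a) b, hD a (E b), hE (D a) b, hE a (D b)]
  abel

/-- Every tree is built from `dot` by `join`, so the Leibniz rule propagates the value at `dot` to
all trees. -/
theorem ext (hD : IsLeibniz D l) (hE : IsLeibniz E m) (hlm : l = m)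
    (h : D (vec dot) = E (vec dot)) : D = E := by
  subst hlm
  refine end_ext_vec fun s => ?_
  induction s using RTree.ind with
  | dot => exact h
  | join c s hc hs => rw [← joinL_vec, hD, hE, hc, hs]

theorem congr (hD : IsLeibniz D l) (h : D = E) (hl : ∀ s, l (vec s) = m (vec s)) :
    IsLeibniz E m := by
  have hl' : l = m := end_ext_vec hl
  rwa [← h, ← hl']

end IsLeibniz

theorem Dplus_vec (t s : RTree) : Dplus t (vec s) = ((RTree.graft t s).map vec).sum := by
  simp [Dplus]

theorem Dplus_dot (t : RTree) : Dplus t (vec dot) = vec (join t dot) := by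
  simp [Dplus_vec, RTree.graft_dot]

theorem sum_map_joinL_left {α : Type*} (m : Multiset α) (f : α → RTree) (s : RTree) :
    (m.map (fun u => vec (join (f u) s))).sum =
      joinL ((m.map (fun u => vec (f u))).sum) (vec s) := by
  induction m using Multiset.induction with
  | empty => simp
  | cons a m h => simp only [Multiset.map_cons, Multiset.sum_cons, h, map_add,
      LinearMap.add_apply, joinL_vec]

theorem sum_map_joinL_right {α : Type*} (m : Multiset α) (f : α → RTree) (c : RTree) :
    (m.map (fun u => vec (join c (f u)))).sum =
      joinL (vec c) ((m.map (fun u => vec (f u))).sum) := by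
  induction m using Multiset.induction with
  | empty => simp
  | cons a m h => simp only [Multiset.map_cons, Multiset.sum_cons, h, map_add, joinL_vec]

theorem isLeibniz_Dplus (t : RTree) : IsLeibniz (Dplus t) 0 := by
  refine isLeibniz_of_vec fun c s => ?_
  rw [Dplus_vec, RTree.graft_join, Multiset.map_add, Multiset.sum_add, Multiset.map_map,
    Multiset.map_map, Function.comp_def, Function.comp_def, sum_map_joinL_left _ (fun u => u),
    sum_map_joinL_right _ (fun u => u), ← Dplus_vec, ← Dplus_vec]
  simp

open Classical in
theorem Dminus_vec (t s : RTree) : Dminus t (vec s) =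
    (((RTree.cuts s).filter (fun e => e.1 = t)).map (fun e => vec e.2)).sum := by
  simp [Dminus]

theorem Dminus_dot (t : RTree) : Dminus t (vec dot) = 0 := by
  simp [Dminus_vec, RTree.cuts_dot]

/-- The functional comes from the edge created by `join`: cutting it removes the whole branch and
contributes exactly when that branch is `t`. -/
theorem isLeibniz_Dminus (t : RTree) : IsLeibniz (Dminus t) (Finsupp.lapply t) := by
  classical
  refine isLeibniz_of_vec fun c s => ?_
  rw [Dminus_vec, RTree.cuts_join, Multiset.filter_add, Multiset.filter_add, Multiset.filter_map,
    Multiset.filter_map, Multiset.map_add, Multiset.map_add, Multiset.sum_add, Multiset.sum_add,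
    Multiset.map_map, Multiset.map_map]
  simp only [Function.comp_def]
  rw [sum_map_joinL_left _ (fun e : RTree × RTree => e.2),
    sum_map_joinL_right _ (fun e : RTree × RTree => e.2)]
  simp only [Dminus_vec, Finsupp.lapply_apply, Multiset.filter_singleton]
  rw [add_comm]
  congr 1
  by_cases h : c = t
  · simp [h]
  · simp [h]

theorem degOp_vec (s : RTree) : degOp (vec s) = (size s : ℂ) • vec s := by
  simp [degOp]

theorem degOp_dot : degOp (vec dot) = vec dot := by simp [degOp_vec]

theorem isLeibniz_degOp : IsLeibniz degOp 0 := by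
  refine isLeibniz_of_vec fun c s => ?_
  simp only [degOp_vec, map_smul, LinearMap.smul_apply, joinL_vec, RTree.size_join, Nat.cast_add,
    add_smul, LinearMap.zero_apply, zero_smul, add_zero]

/-! ### The linear structure of the Lie algebra -/

/-- The span of the trees with more than `n` vertices. -/
def largeTrees (n : ℕ) : Submodule ℂ TreeSpace := Finsupp.supported ℂ ℂ {s | n < size s}

theorem largeTrees_anti {m n : ℕ} (h : m ≤ n) : largeTrees n ≤ largeTrees m :=
  Finsupp.supported_mono fun _ hs => lt_of_le_of_lt h hs

theorem vec_mem_largeTrees {n : ℕ} {s : RTree} (h : n < size s) : vec s ∈ largeTrees n :=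
  Finsupp.single_mem_supported ℂ 1 h

theorem map_largeTrees_le {M : Type*} [AddCommGroup M] [Module ℂ M] {f : TreeSpace →ₗ[ℂ] M} {n : ℕ}
    {V : Submodule ℂ M} (h : ∀ s, n < size s → f (vec s) ∈ V) : ∀ a ∈ largeTrees n, f a ∈ V := by
  intro a ha
  have h1 : largeTrees n ≤ V.comap f := by
    rw [largeTrees, Finsupp.supported_eq_span_single, Submodule.span_le]
    rintro _ ⟨s, hs, rfl⟩
    exact h s hs
  exact h1 ha

theorem size_of_mem_cuts {s : RTree} {e : RTree × RTree} (h : e ∈ RTree.cuts s) :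
    size e.1 + size e.2 = size s := by
  induction s using RTree.ind generalizing e with
  | dot => simp [RTree.cuts_dot] at h
  | join c s hc hs =>
    rw [RTree.cuts_join, Multiset.mem_add, Multiset.mem_add, Multiset.mem_singleton,
      Multiset.mem_map, Multiset.mem_map] at h
    rcases h with rfl | ⟨e, he, rfl⟩ | ⟨e, he, rfl⟩
    · simp
    · have := hc he; simp; omega
    · have := hs he; simp; omega

theorem size_of_mem_graft {t s u : RTree} (h : u ∈ RTree.graft t s) :
    size u = size s + size t := by
  induction s using RTree.ind generalizing u with
  | dot =>
    rw [RTree.graft_dot, Multiset.mem_singleton] at h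
    subst h
    simp; omega
  | join c s hc hs =>
    rw [RTree.graft_join, Multiset.mem_add, Multiset.mem_map, Multiset.mem_map] at h
    rcases h with ⟨e, he, rfl⟩ | ⟨e, he, rfl⟩
    · have := hc he; simp; omega
    · have := hs he; simp; omega

/-- The two-branch terms `joinL a' (joinL a dot)` and `joinL a (joinL a' dot)` coincide and cancel,
so the image of `dot` under the commutator again has no term with several branches. -/
theorem IsLeibniz.lie_dot {D E : Module.End ℂ TreeSpace} {l l' : TreeSpace →ₗ[ℂ] ℂ}
    {a a' : TreeSpace} {z z' : ℂ} (hl : IsLeibniz D l) (hl' : IsLeibniz E l')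
    (ha : D (vec dot) = joinL a (vec dot) + z • vec dot)
    (ha' : E (vec dot) = joinL a' (vec dot) + z' • vec dot) :
    (D * E - E * D) (vec dot) =
      joinL (D a' - E a) (vec dot) + (l a' - l' a) • vec dot := by
  simp only [LinearMap.sub_apply, Module.End.mul_apply, ha, ha', map_add, map_smul,
    hl a' _, hl' a _, smul_add, map_sub, sub_smul]
  rw [joinL_left_comm a a', smul_comm z z']
  abel

/-- The operators which satisfy a Leibniz rule, lower the size of trees by a bounded amount, and map
`dot` to a combination of `dot` and of trees with one branch. -/
def leibnizAlgebra : LieSubalgebra ℂ (Module.End ℂ TreeSpace) where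
  carrier := {D | (∃ N, ∀ n, ∀ a ∈ largeTrees (n + N), D a ∈ largeTrees n) ∧
    (∃ l, IsLeibniz D l ∧ ∃ N, ∀ a ∈ largeTrees N, l a = 0) ∧
    ∃ (a : TreeSpace) (z : ℂ), D (vec dot) = joinL a (vec dot) + z • vec dot}
  zero_mem' := ⟨⟨0, by simp⟩, ⟨0, IsLeibniz.zero, 0, by simp⟩, 0, 0, by simp⟩
  add_mem' := by
    rintro D E ⟨⟨N, hN⟩, ⟨l, hl, K, hK⟩, a, z, ha⟩ ⟨⟨N', hN'⟩, ⟨l', hl', K', hK'⟩, a', z', ha'⟩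
    refine ⟨⟨N + N', fun n b hb => ?_⟩, ⟨l + l', hl.add hl', K + K', fun b hb => ?_⟩, a + a', z + z',
      ?_⟩
    · exact add_mem (hN n b (largeTrees_anti (by omega) hb))
        (hN' n b (largeTrees_anti (by omega) hb))
    · rw [LinearMap.add_apply, hK b (largeTrees_anti (by omega) hb),
        hK' b (largeTrees_anti (by omega) hb), add_zero]
    · rw [LinearMap.add_apply, ha, ha', map_add, LinearMap.add_apply, add_smul]
      abel
  smul_mem' := by
    rintro c D ⟨⟨N, hN⟩, ⟨l, hl, K, hK⟩, a, z, ha⟩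
    refine ⟨⟨N, fun n b hb => Submodule.smul_mem _ _ (hN n b hb)⟩, ⟨c • l, hl.smul c, K,
      fun b hb => ?_⟩, c • a, c * z, ?_⟩
    · rw [LinearMap.smul_apply, hK b hb, smul_zero]
    · rw [LinearMap.smul_apply, ha, map_smul, LinearMap.smul_apply, smul_add, mul_smul]
  lie_mem' := by
    rintro D E ⟨⟨N, hN⟩, ⟨l, hl, K, hK⟩, a, z, ha⟩ ⟨⟨N', hN'⟩, ⟨l', hl', K', hK'⟩, a', z', ha'⟩
    change _ ∧ _ ∧ _
    rw [Ring.lie_def]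
    -- The functional of the commutator is `l ∘ E - l' ∘ D`. Its first term vanishes beyond size `K
    -- + N'`, its second beyond `K' + N`; the sum of the two bounds serves for both.
    refine ⟨⟨N + N', fun n b hb => ?_⟩, ⟨_, hl.lie hl', K + N' + (K' + N), fun b hb => ?_⟩,
      D a' - E a, l a' - l' a, ?_⟩
    · refine sub_mem (hN n _ (hN' (n + N) b ?_)) (hN' n _ (hN (n + N') b ?_))
      · rwa [add_assoc]
      · rwa [add_assoc, add_comm N']
    · rw [LinearMap.sub_apply, LinearMap.comp_apply, LinearMap.comp_apply,
        hK _ (hN' K b (largeTrees_anti (by omega) hb)),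
        hK' _ (hN K' b (largeTrees_anti (by omega) hb)), sub_zero]
    · exact hl.lie_dot hl' ha ha'

theorem Dplus_mem_leibnizAlgebra (t : RTree) : Dplus t ∈ leibnizAlgebra := by
  refine ⟨⟨0, fun n => map_largeTrees_le fun s hs => ?_⟩, ⟨0, isLeibniz_Dplus t, 0, by simp⟩,
    vec t, 0, ?_⟩
  · rw [Dplus_vec]
    refine multiset_sum_mem _ fun a ha => ?_
    obtain ⟨u, hu, rfl⟩ := Multiset.mem_map.1 ha
    have := size_of_mem_graft hu
    exact vec_mem_largeTrees (by omega)
  · rw [Dplus_dot, joinL_vec, zero_smul, add_zero]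

theorem Dminus_mem_leibnizAlgebra (t : RTree) : Dminus t ∈ leibnizAlgebra := by
  classical
  refine ⟨⟨size t, fun n => map_largeTrees_le fun s hs => ?_⟩, ⟨_, isLeibniz_Dminus t, size t, ?_⟩,
    0, 0, ?_⟩
  · rw [Dminus_vec]
    refine multiset_sum_mem _ fun a ha => ?_
    obtain ⟨e, he, rfl⟩ := Multiset.mem_map.1 ha
    obtain ⟨he, het⟩ := Multiset.mem_filter.1 he
    have := size_of_mem_cuts he
    rw [het] at this
    exact vec_mem_largeTrees (by omega)
  · intro a ha
    by_contra h
    have h1 : size t < size t :=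
      (Finsupp.mem_supported ℂ a).1 ha (Finsupp.mem_support_iff.2 h)
    exact lt_irrefl _ h1
  · rw [Dminus_dot]
    simp

theorem degOp_mem_leibnizAlgebra : degOp ∈ leibnizAlgebra := by
  refine ⟨⟨0, fun n => map_largeTrees_le fun s hs => ?_⟩, ⟨0, isLeibniz_degOp, 0, by simp⟩,
    0, 1, ?_⟩
  · rw [degOp_vec]
    exact Submodule.smul_mem _ _ (vec_mem_largeTrees hs)
  · rw [degOp_dot]
    simp

theorem insElim_le_leibnizAlgebra : insElim ≤ leibnizAlgebra := by
  refine LieSubalgebra.lieSpan_le.2 ?_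
  rintro D ((⟨t, rfl⟩ | ⟨t, rfl⟩) | rfl)
  · exact Dplus_mem_leibnizAlgebra t
  · exact Dminus_mem_leibnizAlgebra t
  · exact degOp_mem_leibnizAlgebra

/-- `D⁺_t` as an element of the Lie algebra. -/
def DplusElt (t : RTree) : insElim :=
  ⟨Dplus t, LieSubalgebra.subset_lieSpan (Or.inl (Or.inl ⟨t, rfl⟩))⟩

/-- The linear extension of `D⁺` to the space of trees. -/
def plusElt : TreeSpace →ₗ[ℂ] insElim := Finsupp.linearCombination ℂ DplusElt

/-- The linear extension of `D⁻` to the space of trees. -/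
def minusElt : TreeSpace →ₗ[ℂ] insElim := Finsupp.linearCombination ℂ DminusElt

@[simp]
theorem plusElt_vec (t : RTree) : plusElt (vec t) = DplusElt t := by simp [plusElt]

@[simp]
theorem minusElt_vec (t : RTree) : minusElt (vec t) = DminusElt t := by simp [minusElt]

theorem isLeibniz_plusElt (a : TreeSpace) : IsLeibniz (plusElt a).1 0 := by
  induction a using vec_induction with
  | zero => rw [map_zero]; exact IsLeibniz.zero
  | add a b ha hb => rw [map_add]; simpa using ha.add hb
  | smul z a ha => rw [map_smul]; simpa using ha.smul z
  | basis t => rw [plusElt_vec]; exact isLeibniz_Dplus t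

theorem plusElt_dot (a : TreeSpace) : (plusElt a).1 (vec dot) = joinL a (vec dot) := by
  induction a using vec_induction with
  | zero => simp
  | add a b ha hb => simp [ha, hb]
  | smul z a ha => simp [ha]
  | basis t => rw [plusElt_vec, joinL_vec]; exact Dplus_dot t

theorem isLeibniz_minusElt (b : TreeSpace) :
    IsLeibniz (minusElt b).1 (Finsupp.linearCombination ℂ b) := by
  induction b using vec_induction with
  | zero => exact IsLeibniz.zero.congr (by simp) (by simp)
  | add a b ha hb => exact (ha.add hb).congr (by simp) (by simp)
  | smul z a ha => exact (ha.smul z).congr (by simp) (by simp)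
  | basis t =>
    exact (isLeibniz_Dminus t).congr (by rw [minusElt_vec]; rfl)
      (fun s => by classical simp [Finsupp.single_apply, eq_comm])

theorem minusElt_dot (a : TreeSpace) : (minusElt a).1 (vec dot) = 0 := by
  induction a using vec_induction with
  | zero => simp
  | add a b ha hb => simp [ha, hb]
  | smul z a ha => simp [ha]
  | basis t => rw [minusElt_vec]; exact Dminus_dot t

/-- The elements of the Lie algebra are the combinations of `D⁺_t`, `D⁻_t` and `d`. -/
theorem exists_eq_plus_add_minus (x : insElim) :
    ∃ (a b : TreeSpace) (z : ℂ), x = plusElt a + z • dElt + minusElt b := by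
  obtain ⟨-, ⟨l, hl, N, hN⟩, a, z, ha⟩ := insElim_le_leibnizAlgebra x.2
  -- The coefficient of `D⁻_s` is the value of `l` at `s`; `a` and `z` are read off from the image
  -- of `dot`.
  refine ⟨a, Finsupp.onFinset (RTree.finite_size_le N).toFinset (fun s => l (vec s)) ?_, z, ?_⟩
  · intro s hs
    rw [Set.Finite.mem_toFinset, Set.mem_ofPred_eq]
    by_contra h
    exact hs (hN _ (vec_mem_largeTrees (not_le.1 h)))
  · refine Subtype.ext (hl.ext (((isLeibniz_plusElt a).add
      (isLeibniz_degOp.smul z)).add (isLeibniz_minusElt _)) ?_ ?_)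
    · exact end_ext_vec fun s => by simp
    · change _ = (plusElt a).1 (vec dot) + z • degOp (vec dot) + (minusElt _).1 (vec dot)
      rw [plusElt_dot, minusElt_dot, degOp_dot, ha, add_zero]

/-- The span of the `D⁺_t` is closed under the bracket. -/
theorem lie_DplusElt (t s : RTree) : ∃ a, ⁅DplusElt t, DplusElt s⁆ = plusElt a := by
  refine ⟨Dplus t (vec s) - Dplus s (vec t), Subtype.ext ?_⟩
  rw [LieSubalgebra.coe_bracket, Ring.lie_def]
  refine ((isLeibniz_Dplus t).lie (isLeibniz_Dplus s)).ext (isLeibniz_plusElt _) ?_ ?_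
  · simp
  · rw [plusElt_dot, LinearMap.sub_apply, Module.End.mul_apply, Module.End.mul_apply, Dplus_dot,
      Dplus_dot, map_sub, LinearMap.sub_apply]
    rw [← joinL_vec, ← joinL_vec, isLeibniz_Dplus, isLeibniz_Dplus, Dplus_dot, Dplus_dot]
    simp only [joinL_vec, RTree.join_left_comm t s, LinearMap.zero_apply, zero_smul]
    abel

/-! ### The deformed representation -/

/-- Multiplication by a combination of `dot` and of trees with one branch, for the product which
identifies the roots. Trees with several branches are sent to `0`. -/
def mulL : TreeSpace →ₗ[ℂ] Module.End ℂ TreeSpace :=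
  joinL ∘ₗ Finsupp.lcomapDomain (fun t => join t dot) RTree.join_dot_injective +
    (Finsupp.lapply dot).smulRight 1

theorem mulL_dot : mulL (vec dot) = 1 := by
  have h : Finsupp.lcomapDomain (M := ℂ) (R := ℂ) (fun t => join t dot) RTree.join_dot_injective
      (vec dot) = 0 := by
    ext s
    classical
    simp [Finsupp.lcomapDomain, Finsupp.comapDomain_apply, (RTree.join_ne_dot s dot).symm]
  simp [mulL, h]

theorem mulL_joinL_dot (a : TreeSpace) : mulL (joinL a (vec dot)) = joinL a := by
  induction a using vec_induction with
  | zero => simp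
  | add a b ha hb => simp [ha, hb]
  | smul z a ha => simp [ha]
  | basis t =>
    have h : Finsupp.lcomapDomain (M := ℂ) (R := ℂ) (fun t => join t dot) RTree.join_dot_injective
        (vec (join t dot)) = vec t := by
      ext s
      classical
      simp [Finsupp.lcomapDomain, Finsupp.single_apply]
    rw [joinL_vec]
    simp [mulL, h, RTree.join_ne_dot]

theorem mulL_eq {a b : TreeSpace} {z : ℂ} (h : b = joinL a (vec dot) + z • vec dot) :
    mulL b = joinL a + z • 1 := by
  rw [h, map_add, map_smul, mulL_dot, mulL_joinL_dot]

/-- The deformation of the tautological representation whose lowest weight is `1 + μ`. -/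
def fock (mu : ℂ) : insElim →ₗ⁅ℂ⁆ Module.End ℂ TreeSpace where
  toFun x := x.1 + mu • mulL (x.1 (vec dot))
  map_add' x y := by
    change x.1 + y.1 + mu • mulL (x.1 (vec dot) + y.1 (vec dot)) = _
    rw [map_add]
    module
  map_smul' z x := by
    change z • x.1 + mu • mulL (z • x.1 (vec dot)) = z • _
    rw [map_smul]
    module
  map_lie' := by
    intro x y
    obtain ⟨-, ⟨l, hl, -⟩, a, z, ha⟩ := insElim_le_leibnizAlgebra x.2
    obtain ⟨-, ⟨l', hl', -⟩, a', z', ha'⟩ := insElim_le_leibnizAlgebra y.2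
    rw [LieSubalgebra.coe_bracket, Ring.lie_def, Ring.lie_def, mulL_eq ha, mulL_eq ha',
      mulL_eq (hl.lie_dot hl' ha ha')]
    -- The commutator of `x` with `joinL a'` is `joinL (x a') + l a' • 1`, and multiplications
    -- commute with each other. So the terms linear in `mu` reproduce `IsLeibniz.lie_dot`, and those
    -- quadratic in `mu` cancel.
    refine LinearMap.ext fun b => ?_
    simp only [LinearMap.add_apply, LinearMap.sub_apply, LinearMap.smul_apply,
      Module.End.mul_apply, Module.End.one_apply, map_add, map_smul, map_sub]
    rw [hl a' b, hl' a b, joinL_left_comm a' a b]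
    module

theorem fock_apply (mu : ℂ) (x : insElim) :
    fock mu x = x.1 + mu • mulL (x.1 (vec dot)) := rfl

theorem fock_dot (mu : ℂ) (x : insElim) : fock mu x (vec dot) = (1 + mu) • x.1 (vec dot) := by
  obtain ⟨-, -, a, z, ha⟩ := insElim_le_leibnizAlgebra x.2
  rw [fock_apply, mulL_eq ha]
  simp only [LinearMap.add_apply, LinearMap.smul_apply, Module.End.one_apply, ha]
  module

theorem fock_DplusElt (mu : ℂ) (t : RTree) :
    fock mu (DplusElt t) = Dplus t + mu • joinL (vec t) := by
  change Dplus t + mu • mulL (Dplus t (vec dot)) = _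
  rw [Dplus_dot, ← joinL_vec, mulL_joinL_dot]

theorem fock_DminusElt (mu : ℂ) (t : RTree) : fock mu (DminusElt t) = Dminus t := by
  change Dminus t + mu • mulL (Dminus t (vec dot)) = _
  rw [Dminus_dot, map_zero, smul_zero, add_zero]

theorem fock_dElt_dot (mu : ℂ) : fock mu dElt (vec dot) = (1 + mu) • vec dot := by
  rw [fock_dot]
  exact congrArg _ degOp_dot

/-! ### Triangularity of the products of the operators `D⁺` -/

/-- The span of the trees with fewer than `n` branches. -/
def fewBranches (n : ℕ) : Submodule ℂ TreeSpace :=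
  Finsupp.supported ℂ ℂ {s | Multiset.card (branches s) < n}

theorem vec_mem_fewBranches {n : ℕ} {s : RTree} (h : Multiset.card (branches s) < n) :
    vec s ∈ fewBranches n :=
  Finsupp.single_mem_supported ℂ 1 h

theorem apply_eq_zero_of_mem_fewBranches {n : ℕ} {s : RTree} {a : TreeSpace}
    (ha : a ∈ fewBranches n) (h : n ≤ Multiset.card (branches s)) : a s = 0 := by
  by_contra h1
  have h2 : Multiset.card (branches s) < n :=
    (Finsupp.mem_supported ℂ a).1 ha (Finsupp.mem_support_iff.2 h1)
  omega

theorem map_fewBranches_le {M : Type*} [AddCommGroup M] [Module ℂ M] {f : TreeSpace →ₗ[ℂ] M}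
    {n : ℕ} {V : Submodule ℂ M}
    (h : ∀ s, Multiset.card (branches s) < n → f (vec s) ∈ V) : ∀ a ∈ fewBranches n, f a ∈ V := by
  intro a ha
  have h1 : fewBranches n ≤ V.comap f := by
    rw [fewBranches, Finsupp.supported_eq_span_single, Submodule.span_le]
    rintro _ ⟨s, hs, rfl⟩
    exact h s hs
  exact h1 ha

theorem fewBranches_mono {m n : ℕ} (h : m ≤ n) : fewBranches m ≤ fewBranches n :=
  Finsupp.supported_mono fun _ hs => lt_of_lt_of_le hs h

theorem joinL_vec_mem_fewBranches {n : ℕ} (c : RTree) :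
    ∀ a ∈ fewBranches n, joinL (vec c) a ∈ fewBranches (n + 1) :=
  map_fewBranches_le fun s hs => by
    rw [joinL_vec]
    exact vec_mem_fewBranches (by simpa using hs)

theorem joinL_mem_fewBranches (a : TreeSpace) (s : RTree) :
    joinL a (vec s) ∈ fewBranches (Multiset.card (branches s) + 2) := by
  induction a using vec_induction with
  | zero => simp
  | add a b ha hb => simpa using add_mem ha hb
  | smul z a ha => simpa using Submodule.smul_mem _ z ha
  | basis t =>
    rw [joinL_vec]
    exact vec_mem_fewBranches (by simp)

/-- Grafting at the root adds a branch, while grafting at any other vertex only modifies an existing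
one. -/
theorem Dplus_sub_join_mem (t s : RTree) :
    Dplus t (vec s) - vec (join t s) ∈ fewBranches (Multiset.card (branches s) + 1) := by
  induction s using RTree.ind with
  | dot => simp [Dplus_dot]
  | join c s hc hs =>
    rw [← joinL_vec c s, isLeibniz_Dplus, LinearMap.zero_apply, zero_smul, add_zero,
      RTree.join_left_comm, ← joinL_vec c (join t s), add_sub_assoc, ← map_sub,
      RTree.branches_join, Multiset.card_cons]
    exact add_mem (joinL_mem_fewBranches _ _) (joinL_vec_mem_fewBranches c _ hs)

theorem fock_DplusElt_sub_join_mem (mu : ℂ) (t s : RTree) :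
    fock mu (DplusElt t) (vec s) - (1 + mu) • vec (join t s) ∈
      fewBranches (Multiset.card (branches s) + 1) := by
  rw [fock_DplusElt, LinearMap.add_apply, LinearMap.smul_apply, joinL_vec]
  convert Dplus_sub_join_mem t s using 1
  module

theorem fock_DplusElt_mem_fewBranches (mu : ℂ) (t : RTree) (n : ℕ) :
    ∀ a ∈ fewBranches n, fock mu (DplusElt t) a ∈ fewBranches (n + 1) :=
  map_fewBranches_le fun s hs => by
    have h1 := fewBranches_mono (by omega : _ ≤ n + 1) (fock_DplusElt_sub_join_mem mu t s)
    have h2 : (1 + mu) • vec (join t s) ∈ fewBranches (n + 1) :=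
      Submodule.smul_mem _ _ (vec_mem_fewBranches (by simpa using hs))
    simpa using add_mem h1 h2

/-- The extension of the deformed representation to the enveloping algebra. -/
def fockU (mu : ℂ) : Ug →ₐ[ℂ] Module.End ℂ TreeSpace := UniversalEnvelopingAlgebra.lift ℂ (fock mu)

theorem fockU_ι (mu : ℂ) (x : insElim) :
    fockU mu (UniversalEnvelopingAlgebra.ι ℂ x) = fock mu x :=
  UniversalEnvelopingAlgebra.lift_ι_apply ℂ _ x

/-- The product of the `D⁺_t` in `U(𝔤)`, for `t` in a list. -/
def plusProd (L : List RTree) : Ug :=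
  (L.map (fun t => (UniversalEnvelopingAlgebra.ι ℂ (DplusElt t) : Ug))).prod

@[simp]
theorem plusProd_nil : plusProd [] = 1 := rfl

@[simp]
theorem plusProd_cons (t : RTree) (L : List RTree) :
    plusProd (t :: L) = UniversalEnvelopingAlgebra.ι ℂ (DplusElt t) * plusProd L := by
  simp [plusProd]

/-- Each factor contributes a new branch at the root with coefficient `1 + mu`: one unit from
grafting at the root, and `mu` from the deformation. -/
theorem fockU_plusProd_mem (mu : ℂ) (L : List RTree) :
    fockU mu (plusProd L) (vec dot) - (1 + mu) ^ L.length • vec (ofBranches L) ∈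
      fewBranches L.length := by
  induction L with
  | nil => simp
  | cons t L ih =>
    rw [plusProd_cons, map_mul, Module.End.mul_apply, fockU_ι, List.length_cons]
    have h1 := fock_DplusElt_mem_fewBranches mu t _ _ ih
    have h2 := Submodule.smul_mem _ ((1 + mu) ^ L.length)
      (fock_DplusElt_sub_join_mem mu t (ofBranches L))
    rw [RTree.branches_ofBranches, Multiset.coe_card] at h2
    have h3 := add_mem h1 h2
    rw [map_sub, map_smul, smul_sub, sub_add_sub_cancel, smul_smul, ← pow_succ] at h3
    exact h3

/-- The ordered monomial in the `D⁺_t`, for `t` a branch of a tree, extended linearly. -/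
def monomial : TreeSpace →ₗ[ℂ] Ug :=
  Finsupp.linearCombination ℂ (fun s => plusProd (branches s).toList)

theorem monomial_vec (s : RTree) : monomial (vec s) = plusProd (branches s).toList := by
  simp [monomial]

theorem fockU_monomial_vec_mem (mu : ℂ) (s : RTree) :
    fockU mu (monomial (vec s)) (vec dot) - (1 + mu) ^ Multiset.card (branches s) • vec s ∈
      fewBranches (Multiset.card (branches s)) := by
  have h := fockU_plusProd_mem mu (branches s).toList
  rwa [Multiset.length_toList, Multiset.coe_toList, RTree.ofBranches_branches,
    ← monomial_vec] at h

theorem apply_eq_sum (f : Module.End ℂ TreeSpace) (a : TreeSpace) (u : RTree) :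
    f a u = ∑ s ∈ a.support, a s * f (vec s) u := by
  conv_lhs => rw [← Finsupp.sum_single a, Finsupp.sum]
  rw [map_sum, Finsupp.finsetSum_apply]
  refine Finset.sum_congr rfl fun s _ => ?_
  rw [← smul_eq_mul, ← Finsupp.smul_apply, ← map_smul, Finsupp.smul_single, smul_eq_mul, mul_one]

/-- The linear map sending a combination of monomials to its value on `dot`. -/
def monomialDot (mu : ℂ) : Module.End ℂ TreeSpace :=
  (LinearMap.applyₗ (vec dot)) ∘ₗ (fockU mu).toLinearMap ∘ₗ monomial

/-- The map from `a` to the value at `dot` is triangular for the number of branches, with powers of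
`1 + mu` on the diagonal. It suffices to look at a tree of the support with the most branches. -/
theorem eq_zero_of_fockU_monomial {mu : ℂ} (hmu : 1 + mu ≠ 0) (a : TreeSpace)
    (h : fockU mu (monomial a) (vec dot) = 0) : a = 0 := by
  classical
  by_contra ha
  obtain ⟨s, hs, hmax⟩ := a.support.exists_max_image (fun s => Multiset.card (branches s))
    (Finsupp.support_nonempty_iff.2 ha)
  refine mul_ne_zero (Finsupp.mem_support_iff.1 hs) (pow_ne_zero (Multiset.card (branches s)) hmu) ?_
  have h1 : ∀ u, Multiset.card (branches u) ≤ Multiset.card (branches s) →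
      fockU mu (monomial (vec u)) (vec dot) s =
        if u = s then (1 + mu) ^ Multiset.card (branches s) else 0 := by
    intro u hu
    have h2 := apply_eq_zero_of_mem_fewBranches (fockU_monomial_vec_mem mu u) hu
    rw [Finsupp.sub_apply, sub_eq_zero] at h2
    rw [h2]
    split_ifs with h3
    · simp [h3]
    · simp [h3]
  have h4 : fockU mu (monomial a) (vec dot) s =
      ∑ u ∈ a.support, a u * fockU mu (monomial (vec u)) (vec dot) s :=
    apply_eq_sum (monomialDot mu) a s
  rw [h, Finsupp.zero_apply, Finset.sum_eq_single s] at h4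
  · rw [h1 s le_rfl, if_pos rfl] at h4
    exact h4.symm
  · intro u hu hus
    rw [h1 u (hmax u hu), if_neg hus, mul_zero]
  · intro h5
    exact absurd hs h5

/-! ### Lowering to the one-vertex tree -/

theorem Dminus_eq_zero_of_size_le {t s : RTree} (h : size s ≤ size t) : Dminus t (vec s) = 0 := by
  classical
  rw [Dminus_vec, Multiset.filter_eq_nil.2, Multiset.map_zero, Multiset.sum_zero]
  rintro e he rfl
  have := size_of_mem_cuts he
  have := RTree.size_pos e.2
  omega

open Classical in
/-- If no branch of `s` is larger than `t`, then `D⁻_t` only removes branches at the root. -/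
theorem Dminus_vec_of_branches_le {t s : RTree} (h : ∀ c ∈ branches s, size c ≤ size t) :
    Dminus t (vec s) =
      ((branches s).count t : ℂ) • vec (ofBranches ((branches s).erase t)) := by
  induction s using RTree.ind with
  | dot => simp [Dminus_dot]
  | join c s hc hs =>
    have hs' := hs fun b hb => h b (by simp [hb])
    -- A branch `c` no larger than `t` contains no proper cut equal to `t`, so only the edge from
    -- `c` to the root can matter.
    rw [← joinL_vec, isLeibniz_Dminus, Dminus_eq_zero_of_size_le (h c (by simp)), map_zero,
      LinearMap.zero_apply, zero_add, hs', map_smul, joinL_vec, RTree.branches_join,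
      Finsupp.lapply_apply]
    by_cases hct : c = t
    · subst hct
      rw [Multiset.erase_cons_head, Multiset.count_cons_self, RTree.ofBranches_branches,
        Finsupp.single_eq_same, Nat.cast_succ, add_smul]
      by_cases h1 : c ∈ branches s
      · rw [← RTree.ofBranches_cons, Multiset.cons_erase h1, RTree.ofBranches_branches]
      · rw [Multiset.count_eq_zero_of_notMem h1]
        simp
    · rw [Multiset.erase_cons_tail _ hct, Multiset.count_cons_of_ne (Ne.symm hct),
        RTree.ofBranches_cons, Finsupp.single_eq_of_ne (Ne.symm hct), zero_smul, add_zero]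

/-- Let `t` be a branch of maximal size among all branches of trees in the support. Then `D⁻_t` only
removes copies of `t` at the root, and distinct trees containing such a branch have distinct images,
since adding `t` back recovers them. No cancellation occurs. -/
theorem exists_Dminus_ne_zero {a : TreeSpace} {s : RTree} (hs : s ∈ a.support) (hdot : s ≠ dot) :
    ∃ t, Dminus t a ≠ 0 := by
  classical
  have hne : (a.support.biUnion fun s => (branches s).toFinset).Nonempty := by
    have : branches s ≠ 0 := fun h => hdot (RTree.branches_injective h)
    obtain ⟨c, hc⟩ := Multiset.exists_mem_of_ne_zero this
    exact ⟨c, Finset.mem_biUnion.2 ⟨s, hs, Multiset.mem_toFinset.2 hc⟩⟩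
  obtain ⟨t, ht, hmax⟩ := Finset.exists_max_image _ size hne
  obtain ⟨r, hr, htr⟩ := Finset.mem_biUnion.1 ht
  rw [Multiset.mem_toFinset] at htr
  have hle : ∀ q ∈ a.support, ∀ c ∈ branches q, size c ≤ size t := fun q hq c hc =>
    hmax c (Finset.mem_biUnion.2 ⟨q, hq, Multiset.mem_toFinset.2 hc⟩)
  refine ⟨t, fun h0 => ?_⟩
  have h1 := apply_eq_sum (Dminus t) a (ofBranches ((branches r).erase t))
  rw [h0, Finsupp.zero_apply, Finset.sum_eq_single r] at h1
  · rw [Dminus_vec_of_branches_le (hle r hr), Finsupp.smul_apply, Finsupp.single_eq_same,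
      smul_eq_mul, mul_one] at h1
    exact mul_ne_zero (Finsupp.mem_support_iff.1 hr)
      (Nat.cast_ne_zero.2 (Multiset.count_ne_zero.2 htr)) h1.symm
  · intro q hq hqr
    rw [Dminus_vec_of_branches_le (hle q hq), Finsupp.smul_apply]
    by_cases htq : t ∈ branches q
    · rw [Finsupp.single_eq_of_ne, smul_zero, mul_zero]
      intro h2
      have h3 := congrArg branches h2
      rw [RTree.branches_ofBranches, RTree.branches_ofBranches] at h3
      apply hqr
      apply RTree.branches_injective
      rw [← Multiset.cons_erase htq, ← h3, Multiset.cons_erase htr]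
    · rw [Multiset.count_eq_zero_of_notMem htq, Nat.cast_zero, zero_smul, mul_zero]
  · intro h2
    exact absurd hr h2

theorem size_lt_of_Dminus_ne_zero {t s u : RTree} (h : Dminus t (vec s) u ≠ 0) :
    size u < size s := by
  classical
  by_contra hle
  have h1 : Dminus t (vec s) ∈ Finsupp.supported ℂ ℂ {r | size r < size s} := by
    rw [Dminus_vec]
    refine multiset_sum_mem _ fun a ha => ?_
    obtain ⟨e, he, rfl⟩ := Multiset.mem_map.1 ha
    have h2 := size_of_mem_cuts (Multiset.mem_of_mem_filter he)
    have h3 := RTree.size_pos e.1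
    have h4 : e.2 ∈ {r | size r < size s} := by
      change size e.2 < size s
      omega
    exact Finsupp.single_mem_supported ℂ 1 h4
  exact hle ((Finsupp.mem_supported ℂ _).1 h1 (Finsupp.mem_support_iff.2 h))

/-- Every nonzero vector can be lowered to `dot`. -/
theorem exists_fockU_eq_dot (mu : ℂ) (a : TreeSpace) (ha : a ≠ 0) :
    ∃ y : Ug, fockU mu y a = vec dot := by
  obtain ⟨N, hN⟩ : ∃ N, ∀ s ∈ a.support, size s ≤ N :=
    ⟨a.support.sup size, fun s hs => Finset.le_sup (f := size) hs⟩
  induction N generalizing a with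
  | zero =>
    obtain ⟨s, hs⟩ := Finsupp.support_nonempty_iff.2 ha
    have := hN s hs
    have := RTree.size_pos s
    omega
  | succ N ih =>
    by_cases h : ∃ s ∈ a.support, s ≠ dot
    · obtain ⟨s, hs, hdot⟩ := h
      obtain ⟨t, ht⟩ := exists_Dminus_ne_zero hs hdot
      obtain ⟨y, hy⟩ := ih (Dminus t a) ht fun u hu => by
        rw [Finsupp.mem_support_iff, apply_eq_sum] at hu
        obtain ⟨r, hr, hru⟩ := Finset.exists_ne_zero_of_sum_ne_zero hu
        have := hN r hr
        have := size_lt_of_Dminus_ne_zero (right_ne_zero_of_mul hru)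
        omega
      refine ⟨y * UniversalEnvelopingAlgebra.ι ℂ (DminusElt t), ?_⟩
      rw [map_mul, Module.End.mul_apply, fockU_ι, fock_DminusElt, hy]
    · push Not at h
      have h1 : a = single dot (a dot) := Finsupp.support_subset_singleton.1 fun s hs => by
        rw [h s hs, Finset.mem_singleton]
      have h2 : a dot ≠ 0 := fun h3 => ha (by rw [h1, h3, Finsupp.single_zero])
      refine ⟨algebraMap ℂ Ug (a dot)⁻¹, ?_⟩
      rw [AlgHom.commutes, h1, Module.algebraMap_end_apply, Finsupp.smul_single]
      simp [h2]

/-- The universal enveloping algebra is generated by the Lie algebra. -/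
theorem mem_of_ι_mem {L : Type*} [LieRing L] [LieAlgebra ℂ L]
    (S : Subalgebra ℂ (UniversalEnvelopingAlgebra ℂ L))
    (h : ∀ x : L, UniversalEnvelopingAlgebra.ι ℂ x ∈ S) (u : UniversalEnvelopingAlgebra ℂ L) :
    u ∈ S := by
  let j : L →ₗ⁅ℂ⁆ S :=
    { toFun := fun x => ⟨UniversalEnvelopingAlgebra.ι ℂ x, h x⟩
      map_add' := fun x y => Subtype.ext (map_add _ x y)
      map_smul' := fun z x => Subtype.ext (map_smul _ z x)
      map_lie' := fun {x y} => Subtype.ext (by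
        change UniversalEnvelopingAlgebra.ι ℂ ⁅x, y⁆ = _
        rw [LieHom.map_lie, Ring.lie_def, Ring.lie_def]
        rfl) }
  have h1 : S.val.comp (UniversalEnvelopingAlgebra.lift ℂ j) = AlgHom.id ℂ _ := by
    apply UniversalEnvelopingAlgebra.hom_ext
    ext x
    simp [j]
  have h2 := congrArg (fun f => f u) h1
  simp only [AlgHom.comp_apply, AlgHom.id_apply] at h2
  rw [← h2]
  exact (UniversalEnvelopingAlgebra.lift ℂ j u).2

/-! ### Spanning by ordered monomials -/

section Spanning

variable {W : Type*} [AddCommGroup W] [Module Ug W] [Module ℂ W]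

/-- The span of the vectors obtained by applying fewer than `n` operators `D⁺` to `v`. -/
def shortSpan (v : W) (n : ℕ) : Submodule ℂ W :=
  Submodule.span ℂ {w | ∃ L : List RTree, L.length < n ∧ w = plusProd L • v}

theorem plusProd_smul_mem_shortSpan (v : W) {n : ℕ} {L : List RTree} (h : L.length < n) :
    plusProd L • v ∈ shortSpan v n :=
  Submodule.subset_span ⟨L, h, rfl⟩

theorem shortSpan_le {v : W} {n : ℕ} {V : Submodule ℂ W}
    (h : ∀ L : List RTree, L.length < n → plusProd L • v ∈ V) : shortSpan v n ≤ V := by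
  refine Submodule.span_le.2 ?_
  rintro _ ⟨L, hL, rfl⟩
  exact h L hL

theorem shortSpan_mono (v : W) {m n : ℕ} (h : m ≤ n) : shortSpan v m ≤ shortSpan v n :=
  shortSpan_le fun _ hL => plusProd_smul_mem_shortSpan v (by omega)

variable [IsScalarTower ℂ Ug W]

/-- The action of an element of the enveloping algebra as a linear map over `ℂ`. -/
def actL (u : Ug) : W →ₗ[ℂ] W := (Algebra.lsmul ℂ ℂ W u)

theorem actL_apply (u : Ug) (w : W) : actL u w = u • w := rfl

theorem DplusElt_smul_mem_shortSpan (v : W) (t : RTree) (n : ℕ) {w : W} (hw : w ∈ shortSpan v n) :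
    (UniversalEnvelopingAlgebra.ι ℂ (DplusElt t) : Ug) • w ∈ shortSpan v (n + 1) := by
  have h : shortSpan v n ≤ (shortSpan v (n + 1)).comap
      (actL (UniversalEnvelopingAlgebra.ι ℂ (DplusElt t) : Ug)) :=
    shortSpan_le fun L hL => by
      rw [Submodule.mem_comap, actL_apply, ← mul_smul, ← plusProd_cons]
      exact plusProd_smul_mem_shortSpan v (by simpa using hL)
  exact h hw

theorem plusElt_smul_mem (V : Submodule ℂ W) (w : W)
    (h : ∀ t, (UniversalEnvelopingAlgebra.ι ℂ (DplusElt t) : Ug) • w ∈ V) (a : TreeSpace) :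
    (UniversalEnvelopingAlgebra.ι ℂ (plusElt a) : Ug) • w ∈ V := by
  induction a using vec_induction with
  | zero => simp
  | add a b ha hb => rw [map_add, map_add, add_smul]; exact add_mem ha hb
  | smul z a ha => rw [map_smul, map_smul, smul_assoc]; exact Submodule.smul_mem _ _ ha
  | basis t => rw [plusElt_vec]; exact h t

/-- Up to shorter products, the order of the factors does not matter. -/
theorem plusProd_perm (v : W) {L L' : List RTree} (h : L.Perm L') :
    plusProd L • v - plusProd L' • v ∈ shortSpan v L.length := by
  induction h with
  | nil => simp
  | cons t h ih =>
    rw [plusProd_cons, plusProd_cons, mul_smul, mul_smul, ← smul_sub]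
    exact DplusElt_smul_mem_shortSpan v t _ ih
  | swap s t L =>
    -- Exchanging two factors costs their bracket, which is a combination of single `D⁺` and hence
    -- makes the product shorter by one.
    obtain ⟨a, ha⟩ := lie_DplusElt t s
    have h1 : (UniversalEnvelopingAlgebra.ι ℂ (plusElt a) : Ug) • plusProd L • v ∈
        shortSpan v (L.length + 2) :=
      plusElt_smul_mem _ _ (fun t => by
        rw [← mul_smul, ← plusProd_cons]
        exact plusProd_smul_mem_shortSpan v (by simp)) a
    rw [← ha, LieHom.map_lie, Ring.lie_def, sub_smul] at h1
    simpa [mul_smul] using h1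
  | trans h1 h2 ih1 ih2 =>
    rw [← h1.length_eq] at ih2
    simpa using add_mem ih1 ih2

/-- The span of the ordered monomials applied to `v`. -/
def monomialSpan (v : W) : Submodule ℂ W :=
  LinearMap.range ((LinearMap.toSpanSingleton Ug W v).restrictScalars ℂ ∘ₗ monomial)

/-- A product differs from its rearrangement in the chosen order by shorter products, which the
induction covers. -/
theorem shortSpan_le_monomialSpan (v : W) (n : ℕ) : shortSpan v n ≤ monomialSpan v := by
  induction n with
  | zero => exact shortSpan_le fun L hL => absurd hL (Nat.not_lt_zero _)
  | succ n ih =>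
    refine shortSpan_le fun L hL => ?_
    have h1 : (branches (ofBranches L)).toList.Perm L := by
      rw [← Multiset.coe_eq_coe, Multiset.coe_toList, RTree.branches_ofBranches]
    have h2 := ih (shortSpan_mono v (by omega) (plusProd_perm v h1.symm))
    rw [← monomial_vec] at h2
    have h3 : monomial (vec (ofBranches L)) • v ∈ monomialSpan v := ⟨_, rfl⟩
    simpa using add_mem h2 h3

/-- The submodule generated by a lowest weight vector is spanned by the ordered monomials. -/
theorem exists_monomial_smul_eq {v : W} {lam : ℂ}
    (hd : (UniversalEnvelopingAlgebra.ι ℂ dElt : Ug) • v = lam • v)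
    (hminus : ∀ t, (UniversalEnvelopingAlgebra.ι ℂ (DminusElt t) : Ug) • v = 0) (u : Ug) :
    ∃ a, monomial a • v = u • v := by
  let V : Submodule ℂ W := Submodule.span ℂ (Set.range fun L : List RTree => plusProd L • v)
  have hV : ∀ L : List RTree, plusProd L • v ∈ V := fun L => Submodule.subset_span ⟨L, rfl⟩
  have hle : ∀ {V' : Submodule ℂ W}, (∀ L : List RTree, plusProd L • v ∈ V') → V ≤ V' := fun h => by
    refine Submodule.span_le.2 ?_
    rintro _ ⟨L, rfl⟩
    exact h L
  have hplus : ∀ t, ∀ w ∈ V, (UniversalEnvelopingAlgebra.ι ℂ (DplusElt t) : Ug) • w ∈ V := by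
    intro t
    refine hle (V' := V.comap (actL (UniversalEnvelopingAlgebra.ι ℂ (DplusElt t) : Ug)))
      fun L => ?_
    rw [Submodule.mem_comap, actL_apply, ← mul_smul, ← plusProd_cons]
    exact hV _
  have hmon : ∀ (L : List RTree) (x : insElim),
      (UniversalEnvelopingAlgebra.ι ℂ x : Ug) • plusProd L • v ∈ V := by
    intro L
    induction L with
    | nil =>
      intro x
      obtain ⟨a, b, z, rfl⟩ := exists_eq_plus_add_minus x
      rw [plusProd_nil, one_smul, map_add, map_add, map_smul, add_smul, add_smul, smul_assoc, hd]
      have hv : v ∈ V := by simpa using hV []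
      refine add_mem (add_mem ?_ (Submodule.smul_mem _ _ (Submodule.smul_mem _ _ hv))) ?_
      · exact plusElt_smul_mem V v (fun t => hplus t v hv) a
      · induction b using vec_induction with
        | zero => simp
        | add a b ha hb => rw [map_add, map_add, add_smul]; exact add_mem ha hb
        | smul z a ha => rw [map_smul, map_smul, smul_assoc]; exact Submodule.smul_mem _ _ ha
        | basis t => rw [minusElt_vec, hminus]; exact zero_mem _
    | cons t L ih =>
      intro x
      -- Moving `x` past the first factor leaves the bracket acting on a shorter product; this is
      -- why the induction is uniform in `x`.
      have h1 := ih ⁅x, DplusElt t⁆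
      rw [LieHom.map_lie, Ring.lie_def, sub_smul, mul_smul, mul_smul] at h1
      have h2 := hplus t _ (ih x)
      rw [plusProd_cons, mul_smul]
      simpa using add_mem h1 h2
  let S : Subalgebra ℂ Ug :=
    { carrier := {u | ∀ w ∈ V, u • w ∈ V}
      mul_mem' := fun {a b} ha hb w hw => by rw [mul_smul]; exact ha _ (hb _ hw)
      add_mem' := fun {a b} ha hb w hw => by rw [add_smul]; exact add_mem (ha _ hw) (hb _ hw)
      algebraMap_mem' := fun z w hw => by
        rw [algebraMap_smul]; exact Submodule.smul_mem _ _ hw }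
  have hS : u ∈ S := mem_of_ι_mem S (fun x => hle
    (V' := V.comap (actL (UniversalEnvelopingAlgebra.ι ℂ x : Ug))) fun L => hmon L x) u
  have hu : u • v ∈ V := hS v (by simpa using hV [])
  exact hle (V' := monomialSpan v) (fun L => shortSpan_le_monomialSpan v (L.length + 1)
    (plusProd_smul_mem_shortSpan v (Nat.lt_succ_self _))) hu

end Spanning

/-! ### The module `W(λ)` -/

/-- The lowest weight vector of `W(λ)`. -/
def lowestVec (lam : ℂ) : Verma lam := (balanceRel lam).mkQ (1 ⊗ₜ[ℂ] 1)

theorem smul_lowestVec (lam : ℂ) (u : Ug) : u • lowestVec lam = (balanceRel lam).mkQ (u ⊗ₜ[ℂ] 1) := by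
  rw [lowestVec, ← map_smul, TensorProduct.smul_tmul', smul_eq_mul, mul_one]

theorem exists_smul_lowestVec (lam : ℂ) (w : Verma lam) : ∃ u : Ug, u • lowestVec lam = w := by
  obtain ⟨x, rfl⟩ := (balanceRel lam).mkQ_surjective w
  induction x using TensorProduct.induction_on with
  | zero => exact ⟨0, by simp⟩
  | tmul u z =>
    refine ⟨z • u, ?_⟩
    rw [smul_lowestVec, TensorProduct.smul_tmul, smul_eq_mul, mul_one]
  | add x y hx hy =>
    obtain ⟨u, hu⟩ := hx
    obtain ⟨u', hu'⟩ := hy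
    exact ⟨u + u', by rw [add_smul, hu, hu', map_add]⟩

theorem lowerIncl_smul_lowestVec (lam : ℂ) (p : Polynomial ℂ) (y : Un) :
    lowerIncl p y • lowestVec lam = lowerScalar lam p y • lowestVec lam := by
  rw [smul_lowestVec, lowestVec, ← sub_eq_zero]
  have h : (1 * lowerIncl p y) ⊗ₜ[ℂ] (1 : ℂ) - (1 : Ug) ⊗ₜ[ℂ] (lowerScalar lam p y * 1) ∈
      balanceRel lam := Submodule.subset_span ⟨1, p, y, 1, rfl⟩
  have h1 := (Submodule.Quotient.mk_eq_zero _).2 h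
  rw [one_mul, ← smul_eq_mul (lowerScalar lam p y), TensorProduct.tmul_smul] at h1
  exact h1

theorem dElt_smul_lowestVec (lam : ℂ) :
    (UniversalEnvelopingAlgebra.ι ℂ dElt : Ug) • lowestVec lam = lam • lowestVec lam := by
  simpa [lowerIncl, lowerScalar] using lowerIncl_smul_lowestVec lam Polynomial.X 1

theorem DminusElt_smul_lowestVec (lam : ℂ) (t : RTree) :
    (UniversalEnvelopingAlgebra.ι ℂ (DminusElt t) : Ug) • lowestVec lam = 0 := by
  have h : DminusElt t ∈ nMinus := LieSubalgebra.subset_lieSpan ⟨t, rfl⟩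
  have h1 := lowerIncl_smul_lowestVec lam 1 (UniversalEnvelopingAlgebra.ι ℂ ⟨_, h⟩)
  simpa [lowerIncl, lowerScalar, unIncl] using h1

/-- Universal property of `W(λ)`. -/
theorem lift_apply_eq_zero {M : Type*} [AddCommGroup M] [Module ℂ M]
    (f : insElim →ₗ⁅ℂ⁆ Module.End ℂ M) {m : M} {lam : ℂ} (hd : f dElt m = lam • m)
    (hminus : ∀ t, f (DminusElt t) m = 0) {u : Ug} (hu : u • lowestVec lam = 0) :
    UniversalEnvelopingAlgebra.lift ℂ f u m = 0 := by
  set F := UniversalEnvelopingAlgebra.lift ℂ f with hF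
  have hn : ∀ x ∈ nMinus, f x m = 0 := by
    intro x hx
    induction hx using LieSubalgebra.lieSpan_induction with
    | mem x h => obtain ⟨t, rfl⟩ := h; exact hminus t
    | zero => simp
    | add x y _ _ hx hy => simp [hx, hy]
    | smul z x _ hx => simp [hx]
    | lie x y _ _ hx hy =>
      rw [LieHom.map_lie, Ring.lie_def]
      simp [hx, hy]
  have hy : ∀ y : Un, F (unIncl y) m = UniversalEnvelopingAlgebra.lift ℂ (0 : nMinus →ₗ⁅ℂ⁆ ℂ) y • m := by
    let S : Subalgebra ℂ Un :=
      { carrier := {y | F (unIncl y) m =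
          UniversalEnvelopingAlgebra.lift ℂ (0 : nMinus →ₗ⁅ℂ⁆ ℂ) y • m}
        mul_mem' := fun {a b} ha hb => by
          change F (unIncl (a * b)) m = _
          rw [map_mul, map_mul, map_mul, Module.End.mul_apply, hb, map_smul, ha, smul_smul, mul_comm]
        add_mem' := fun {a b} ha hb => by
          change F (unIncl (a + b)) m = _
          rw [map_add, map_add, map_add, LinearMap.add_apply, ha, hb, add_smul]
        algebraMap_mem' := fun z => by
          change F (unIncl (algebraMap ℂ _ z)) m = _
          rw [AlgHom.commutes, AlgHom.commutes, AlgHom.commutes]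
          rfl }
    refine mem_of_ι_mem S fun x => ?_
    change F (unIncl _) m = _
    rw [unIncl, UniversalEnvelopingAlgebra.lift_ι_apply, UniversalEnvelopingAlgebra.lift_ι_apply,
      LieHom.comp_apply, hF, UniversalEnvelopingAlgebra.lift_ι_apply]
    simpa using hn _ x.2
  have hp : ∀ p : Polynomial ℂ,
      F (Polynomial.aeval (UniversalEnvelopingAlgebra.ι ℂ dElt : Ug) p) m = p.eval lam • m := by
    intro p
    rw [← Polynomial.aeval_algHom_apply, hF, UniversalEnvelopingAlgebra.lift_ι_apply]
    by_cases hm : m = 0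
    · simp [hm]
    · exact Module.End.aeval_apply_of_hasEigenvector ⟨Module.End.mem_eigenspace_iff.2 hd, hm⟩
  let T : Ug ⊗[ℂ] ℂ →ₗ[ℂ] M :=
    TensorProduct.lift
      (((LinearMap.lsmul ℂ M).flip ∘ₗ LinearMap.applyₗ m) ∘ₗ F.toLinearMap)
  have hT : ∀ u z, T (u ⊗ₜ z) = z • F u m := fun u z => rfl
  have hTsmul : ∀ (u : Ug) (x : Ug ⊗[ℂ] ℂ), T (u • x) = F u (T x) := by
    intro u x
    induction x using TensorProduct.induction_on with
    | zero => simp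
    | tmul u' z =>
      rw [TensorProduct.smul_tmul', hT, hT, smul_eq_mul, map_mul, Module.End.mul_apply, map_smul]
    | add x y hx hy => rw [smul_add, map_add, map_add, map_add, hx, hy]
  have hker : ∀ x ∈ balanceRel lam, T x = 0 := by
    intro x hx
    induction hx using Submodule.span_induction with
    | mem x h =>
      obtain ⟨u, p, y, z, rfl⟩ := h
      rw [map_sub, hT, hT, lowerIncl, map_mul, map_mul, Module.End.mul_apply, Module.End.mul_apply,
        hy, map_smul, hp, map_smul, map_smul, lowerScalar, smul_smul, smul_smul, sub_eq_zero]
      congr 1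
      ring
    | zero => exact map_zero T
    | add x y _ _ hx hy => rw [map_add, hx, hy, add_zero]
    | smul u x _ hx => rw [hTsmul, hx, map_zero]
  rw [smul_lowestVec] at hu
  have h := hker _ ((Submodule.Quotient.mk_eq_zero _).1 hu)
  rwa [hT, one_smul] at h

theorem fockU_apply_eq_zero {lam mu : ℂ} (h : 1 + mu = lam) {u : Ug}
    (hu : u • lowestVec lam = 0) : fockU mu u (vec dot) = 0 := by
  refine lift_apply_eq_zero (fock mu) (lam := lam) ?_ (fun t => ?_) hu
  · rw [fock_dElt_dot, h]
  · rw [fock_DminusElt, Dminus_dot]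

theorem lowestVec_ne_zero (lam : ℂ) : lowestVec lam ≠ 0 := by
  intro h
  have h1 := fockU_apply_eq_zero (add_sub_cancel 1 lam) (u := 1) (by rw [h, smul_zero])
  rw [map_one, Module.End.one_apply] at h1
  exact one_ne_zero (Finsupp.single_eq_zero.1 h1)

/-- An element of `Ug` that kills `dot` in `fock` also kills the lowest weight vector: replace it by
a combination of monomials and use their independence. Thus lowering to `dot` in `fock` lifts to
`W(lam)`. -/
theorem isSimpleModule_verma {lam : ℂ} (hlam : lam ≠ 0) : IsSimpleModule Ug (Verma lam) := by
  have hmu : 1 + (lam - 1) = lam := add_sub_cancel 1 lam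
  have hspan := exists_monomial_smul_eq (dElt_smul_lowestVec lam) (DminusElt_smul_lowestVec lam)
  refine isSimpleModule_iff_toSpanSingleton_surjective.2 ⟨⟨_, _, lowestVec_ne_zero lam⟩, ?_⟩
  intro w hw w'
  obtain ⟨u, rfl⟩ := exists_smul_lowestVec lam w
  obtain ⟨u', rfl⟩ := exists_smul_lowestVec lam w'
  have h1 : fockU (lam - 1) u (vec dot) ≠ 0 := by
    obtain ⟨a, ha⟩ := hspan u
    intro h
    have h2 := fockU_apply_eq_zero hmu (u := monomial a - u) (by rw [sub_smul, ha, sub_self])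
    rw [map_sub, LinearMap.sub_apply, h, sub_zero] at h2
    rw [eq_zero_of_fockU_monomial (by rwa [hmu]) a h2, map_zero, zero_smul] at ha
    exact hw ha.symm
  obtain ⟨y, hy⟩ := exists_fockU_eq_dot (lam - 1) _ h1
  -- Since `y * u - 1` kills `dot`, it kills the lowest weight vector, which therefore lies in the
  -- submodule generated by `w`.
  obtain ⟨a, ha⟩ := hspan (y * u - 1)
  have h2 := fockU_apply_eq_zero hmu (u := monomial a - (y * u - 1))
    (by rw [sub_smul, ha, sub_self])
  rw [map_sub, map_sub, map_mul, map_one, LinearMap.sub_apply, LinearMap.sub_apply,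
    Module.End.mul_apply, hy, Module.End.one_apply, sub_self, sub_zero] at h2
  rw [eq_zero_of_fockU_monomial (by rwa [hmu]) a h2, map_zero, zero_smul, sub_smul, one_smul,
    eq_comm, sub_eq_zero] at ha
  refine ⟨u' * y, ?_⟩
  rw [LinearMap.toSpanSingleton_apply, mul_smul, ← mul_smul y, ha]

/-! ### Reducibility at weight zero -/

/-- The tensor product of two representations. -/
def tensorRep {L M N : Type*} [LieRing L] [LieAlgebra ℂ L] [AddCommGroup M] [Module ℂ M]
    [AddCommGroup N] [Module ℂ N] (f : L →ₗ⁅ℂ⁆ Module.End ℂ M) (g : L →ₗ⁅ℂ⁆ Module.End ℂ N) :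
    L →ₗ⁅ℂ⁆ Module.End ℂ (M ⊗[ℂ] N) where
  toFun x := (f x).rTensor N + (g x).lTensor M
  map_add' x y := by
    rw [map_add, map_add, LinearMap.rTensor_add, LinearMap.lTensor_add]
    abel
  map_smul' z x := by
    rw [map_smul, map_smul, LinearMap.rTensor_smul, LinearMap.lTensor_smul, ← smul_add]
    rfl
  map_lie' := by
    intro x y
    rw [LieHom.map_lie, LieHom.map_lie, Ring.lie_def, Ring.lie_def, Ring.lie_def]
    refine TensorProduct.ext' fun a b => ?_
    simp only [LinearMap.add_apply, LinearMap.sub_apply, Module.End.mul_apply,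
      LinearMap.rTensor_tmul, LinearMap.lTensor_tmul, map_add, TensorProduct.sub_tmul,
      TensorProduct.tmul_sub]
    abel

theorem tensorRep_fock_dot (x : insElim) :
    tensorRep (fock 0) (fock (-2)) x (vec dot ⊗ₜ[ℂ] vec dot) =
      x.1 (vec dot) ⊗ₜ[ℂ] vec dot - vec dot ⊗ₜ[ℂ] x.1 (vec dot) := by
  change (fock 0 x (vec dot)) ⊗ₜ[ℂ] vec dot + vec dot ⊗ₜ[ℂ] (fock (-2) x (vec dot)) = _
  rw [fock_dot, fock_dot, add_zero, one_smul, TensorProduct.tmul_smul]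
  module

/-- No single `fock` module detects this, as the one of weight `0` kills the vector. In the tensor
product of weights `1` and `-1`, `dot ⊗ dot` also satisfies the lowest weight conditions at weight
`0`, but is not killed by `D⁺_dot`. -/
theorem DplusElt_smul_lowestVec_ne_zero :
    (UniversalEnvelopingAlgebra.ι ℂ (DplusElt dot) : Ug) • lowestVec 0 ≠ 0 := by
  classical
  intro h
  have h1 := lift_apply_eq_zero (tensorRep (fock 0) (fock (-2))) (m := vec dot ⊗ₜ[ℂ] vec dot) (lam := 0)
    (by
      rw [tensorRep_fock_dot]
      change degOp _ ⊗ₜ[ℂ] _ - _ ⊗ₜ[ℂ] degOp _ = _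
      rw [degOp_dot, sub_self, zero_smul])
    (fun t => by
      rw [tensorRep_fock_dot]
      change Dminus t _ ⊗ₜ[ℂ] _ - _ ⊗ₜ[ℂ] Dminus t _ = _
      rw [Dminus_dot, TensorProduct.zero_tmul, TensorProduct.tmul_zero, sub_self]) h
  rw [UniversalEnvelopingAlgebra.lift_ι_apply, tensorRep_fock_dot] at h1
  change Dplus dot _ ⊗ₜ[ℂ] _ - _ ⊗ₜ[ℂ] Dplus dot _ = _ at h1
  rw [Dplus_dot] at h1
  -- Extract the coefficient of `join dot dot ⊗ dot`, which is `1` on the left side.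
  have h2 := congrArg (fun x => TensorProduct.lid ℂ ℂ
    (TensorProduct.map (Finsupp.lapply (join dot dot)) (Finsupp.lapply dot) x)) h1
  simp [(RTree.join_ne_dot dot dot), (RTree.join_ne_dot dot dot).symm] at h2

theorem not_isSimpleModule_verma_zero : ¬ IsSimpleModule Ug (Verma 0) := by
  intro h
  obtain ⟨u, hu⟩ := (isSimpleModule_iff_toSpanSingleton_surjective.1 h).2 _
    DplusElt_smul_lowestVec_ne_zero (lowestVec 0)
  rw [LinearMap.toSpanSingleton_apply] at hu
  -- At `mu = -1` the factor `1 + mu` vanishes, so `D⁺_dot` kills `dot` and the relation would force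
  -- `dot` itself to be zero.
  have h1 := fockU_apply_eq_zero (lam := 0) (mu := -1) (by ring)
    (u := u * UniversalEnvelopingAlgebra.ι ℂ (DplusElt dot) - 1)
    (by rw [sub_smul, mul_smul, hu, one_smul, sub_self])
  rw [map_sub, map_mul, map_one, LinearMap.sub_apply, Module.End.mul_apply, fockU_ι, fock_dot,
    add_neg_cancel, zero_smul, map_zero, zero_sub, neg_eq_zero, Module.End.one_apply] at h1
  exact one_ne_zero (Finsupp.single_eq_zero.1 h1)

end InsElim

end

theorem mainTheorem4 :
    ∃ S : Set ℂ, S.Countable ∧ (0 : ℂ) ∈ S ∧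
      (∀ lam : ℂ, lam ∉ S → IsSimpleModule InsElim.Ug (InsElim.Verma lam)) ∧
      ¬ IsSimpleModule InsElim.Ug (InsElim.Verma 0) := by
  refine ⟨{0}, Set.countable_singleton 0, rfl, fun lam hlam => ?_, ?_⟩
  · exact InsElim.isSimpleModule_verma hlam
  · exact InsElim.not_isSimpleModule_verma_zero
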